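/- Let $G$ be a compact, second countable (Hausdorff) topological group with Haar measure, and let $A$ be a discrete $G$-module, that is, a discrete abelian group on which $G$ acts continuously by automorphisms. For $p \ge 0$ let $\mathcal{C}^p(G,A)$ be the group of Haar-almost-everywhere equivalence classes of Borel maps $G^p \to A$ (so $\mathcal{C}^0(G,A)=A$), let $d:\mathcal{C}^p(G,A)\to\mathcal{C}^{p+1}(G,A)$ be the coboundary $$d\phi(g_1,\dots,g_{p+1}) = g_1\cdot\phi(g_2,\dots,g_{p+1}) + \sum_{i=1}^{p}(-1)^i\phi(g_1,\dots,g_ig_{i+1},\dots,g_{p+1}) + (-1)^{p+1}\phi(g_1,\dots,g_p),$$ and let $\mathrm{H}^p_{\mathrm{m}}(G,A)$ be the quotient of $\ker\big(d|_{\mathcal{C}^p(G,A)}\big)$ by $d\big(\mathcal{C}^{p-1}(G,A)\big)$ (by $0$ if $p=0$): the $p$-th measurable cohomology group of $G$ with coefficients in $A$. Let $(A_m)_{m\in I}$ be a family of $G$-submodules of $A$ indexed by a directed preordered set $I$, with $A_m\subseteq A_{m'}$ whenever $m\le m'$ and with $\bigcup_{m\in I} A_m = A$. Then for every $p\ge 0$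 the homomorphism $$\varinjlim_{m}\mathrm{H}^p_{\mathrm{m}}(G,A_m)\longrightarrow \mathrm{H}^p_{\mathrm{m}}(G,A)$$ induced by the inclusions $A_m\subseteq A$ is an isomorphism, where the direct limit is taken along the maps induced by the inclusions $A_m\subseteq A_{m'}$ for $m\le m'$. -/

import Mathlib

open MeasureTheory

noncomputable section

namespace MeasurableCohomology

/-! ### Cochains -/

section Cochains

variable {G : Type*} [Group G] [TopologicalSpace G] [IsTopologicalGroup G] [LocallyCompactSpace G]
  [MeasurableSpace G] [BorelSpace G]

/-- The product Haar measure on `G ^ p`. (Only its null sets matter below, so its normalization is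
irrelevant.) On `G ^ 0` it is the unit mass on the single point. -/
abbrev haarPow (G : Type*) [Group G] [TopologicalSpace G] [IsTopologicalGroup G]
    [LocallyCompactSpace G] [MeasurableSpace G] [BorelSpace G] (p : ℕ) : Measure (Fin p → G) :=
  Measure.pi fun _ => Measure.haar

/-- The group `C^p(G, A)` of Haar-almost-everywhere equivalence classes of measurable maps
`G ^ p → A`. For `p = 0` this is (canonically) `A`. -/
abbrev Cochain (G : Type*) [Group G] [TopologicalSpace G] [IsTopologicalGroup G]
    [LocallyCompactSpace G] [MeasurableSpace G] [BorelSpace G]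
    (A : Type*) [TopologicalSpace A] (p : ℕ) :=
  (Fin p → G) →ₘ[haarPow G p] A

variable [SecondCountableTopology G]

theorem contractNth_eq {G : Type*} [Group G] {n : ℕ} (j : Fin (n + 1)) (g : Fin (n + 1) → G) :
    Fin.contractNth j (· * ·) g =
      (fun k : Fin n => if (k : ℕ) = j then g j else 1) * j.removeNth g := by
  funext k
  by_cases h : (k : ℕ) = j
  · have h1 : j = k.castSucc := Fin.ext h.symm
    subst h1
    simp [Fin.contractNth, Fin.removeNth]
  · simp [Fin.contractNth_apply_of_ne _ _ _ _ (Ne.symm h), h, Fin.removeNth]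

/-- Each map `(g₁, …, g_{p+1}) ↦ (g₁, …, gᵢ gᵢ₊₁, …, g_{p+1})`, and the map that drops the last
coordinate, pulls null sets back to null sets. -/
theorem quasiMeasurePreserving_contractNth {n : ℕ} (j : Fin (n + 1)) :
    Measure.QuasiMeasurePreserving (fun g : Fin (n + 1) → G => Fin.contractNth j (· * ·) g)
      (haarPow G (n + 1)) (haarPow G n) := by
  have h1 := (measurePreserving_piFinSuccAbove (fun _ : Fin (n + 1) => (Measure.haar : Measure G))
    j).quasiMeasurePreserving
  have hc : Measurable fun x : G => (fun k : Fin n => if (k : ℕ) = j then x else 1) := by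
    refine measurable_pi_lambda _ fun k => ?_
    by_cases h : (k : ℕ) = j
    · simp only [h, if_true]
      exact measurable_id
    · simp [h]
  have h2 : Measure.QuasiMeasurePreserving
      (fun q : G × (Fin n → G) => (fun k : Fin n => if (k : ℕ) = j then q.1 else 1) * q.2)
      ((Measure.haar : Measure G).prod (haarPow G n)) (haarPow G n) := by
    refine QuasiMeasurePreserving.prod_of_right
      ((hc.comp measurable_fst).mul measurable_snd) (Filter.Eventually.of_forall fun x => ?_)
    exact (measurePreserving_mul_left (Measure.pi fun _ : Fin n => (Measure.haar : Measure G))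
      (fun k : Fin n => if (k : ℕ) = j then x else 1)).quasiMeasurePreserving
  have h3 := h2.comp h1
  have h4 : (fun g : Fin (n + 1) → G => Fin.contractNth j (· * ·) g) =
      (fun q : G × (Fin n → G) => (fun k : Fin n => if (k : ℕ) = j then q.1 else 1) * q.2) ∘
        (MeasurableEquiv.piFinSuccAbove (fun _ => G) j) := by
    funext g
    rw [contractNth_eq]
    rfl
  rw [h4]
  exact h3

/-- The map `(g₁, …, g_{p+1}) ↦ (g₂, …, g_{p+1})` pulls null sets back to null sets. -/
theorem quasiMeasurePreserving_tail {n : ℕ} :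
    Measure.QuasiMeasurePreserving (fun g : Fin (n + 1) → G => Fin.tail g)
      (haarPow G (n + 1)) (haarPow G n) := by
  have h1 := (measurePreserving_piFinSuccAbove (fun _ : Fin (n + 1) => (Measure.haar : Measure G))
    0).quasiMeasurePreserving
  have h2 : Measure.QuasiMeasurePreserving (Prod.snd : G × (Fin n → G) → _)
      ((Measure.haar : Measure G).prod (haarPow G n)) (haarPow G n) :=
    Measure.quasiMeasurePreserving_snd
  exact h2.comp h1

variable [T2Space G] {A : Type*} [AddCommGroup A] [TopologicalSpace A] [IsTopologicalAddGroup A]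
  [DistribMulAction G A] [ContinuousSMul G A]

/-- The class of the projection `(g₁, …, g_{p+1}) ↦ g₁`. -/
def firstCoord (G : Type*) [Group G] [TopologicalSpace G] [IsTopologicalGroup G]
    [LocallyCompactSpace G] [MeasurableSpace G] [BorelSpace G] [SecondCountableTopology G]
    [T2Space G] (p : ℕ) : (Fin (p + 1) → G) →ₘ[haarPow G (p + 1)] G :=
  AEEqFun.mk (fun g => g 0) (continuous_apply (0 : Fin (p + 1))).aestronglyMeasurable

/-- The coboundary: almost everywhere,
`(dφ)(g₁, …, g_{p+1}) = g₁ • φ(g₂, …, g_{p+1}) + ∑ᵢ (-1)ⁱ φ(g₁, …, gᵢ gᵢ₊₁, …, g_{p+1})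
  + (-1)^(p+1) φ(g₁, …, g_p)`.
In the sum below, the index `j < p` (counted from `0`) gives the term `i = j + 1`, and `j = p` gives
the last term, because contracting at the last index drops the last coordinate. -/
def dFun (p : ℕ) (φ : Cochain G A p) : Cochain G A (p + 1) :=
  AEEqFun.comp₂ (fun (g : G) (a : A) => g • a) continuous_smul (firstCoord G p)
      (φ.compQuasiMeasurePreserving _ quasiMeasurePreserving_tail) +
    ∑ j : Fin (p + 1), (-1 : ℤ) ^ ((j : ℕ) + 1) •
      φ.compQuasiMeasurePreserving _ (quasiMeasurePreserving_contractNth j)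

/-- Composition with a quasi-measure-preserving map is additive. -/
theorem compQuasiMeasurePreserving_add {X Y : Type*} [MeasurableSpace X] [MeasurableSpace Y]
    {μ : Measure X} {ν : Measure Y} {f : X → Y} (hf : Measure.QuasiMeasurePreserving f μ ν)
    (φ ψ : Y →ₘ[ν] A) :
    (φ + ψ).compQuasiMeasurePreserving f hf =
      φ.compQuasiMeasurePreserving f hf + ψ.compQuasiMeasurePreserving f hf := by
  induction φ using AEEqFun.induction_on
  induction ψ using AEEqFun.induction_on
  rfl

theorem dFun_add (p : ℕ) (φ ψ : Cochain G A p) : dFun p (φ + ψ) = dFun p φ + dFun p ψ := by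
  have h : ∀ (F : (Fin (p + 1) → G) →ₘ[haarPow G (p + 1)] G) (x y : Cochain G A (p + 1)),
      AEEqFun.comp₂ (fun (g : G) (a : A) => g • a) continuous_smul F (x + y) =
        AEEqFun.comp₂ (fun (g : G) (a : A) => g • a) continuous_smul F x +
        AEEqFun.comp₂ (fun (g : G) (a : A) => g • a) continuous_smul F y := by
    intro F x y
    induction F using AEEqFun.induction_on
    induction x using AEEqFun.induction_on
    induction y using AEEqFun.induction_on
    rename_i f hf f₁ h₁ f₂ h₂
    rw [AEEqFun.mk_add_mk]
    refine Eq.trans (AEEqFun.comp₂_mk_mk _ continuous_smul _ _ _ _) (Eq.trans ?_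
      (congrArg₂ (· + ·) (AEEqFun.comp₂_mk_mk _ continuous_smul _ _ _ _)
        (AEEqFun.comp₂_mk_mk _ continuous_smul _ _ _ _)).symm)
    refine Eq.trans ?_ (AEEqFun.mk_add_mk _ _ _ _).symm
    congr 1
    funext g
    exact smul_add (f g) (f₁ g) (f₂ g)
  simp only [dFun, compQuasiMeasurePreserving_add, h, smul_add, Finset.sum_add_distrib]
  abel

/-- The coboundary homomorphism `d : C^p(G, A) → C^{p+1}(G, A)`. -/
def d (G : Type*) [Group G] [TopologicalSpace G] [IsTopologicalGroup G]
    [LocallyCompactSpace G] [MeasurableSpace G] [BorelSpace G] [SecondCountableTopology G]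
    [T2Space G] (A : Type*) [AddCommGroup A] [TopologicalSpace A] [IsTopologicalAddGroup A]
    [DistribMulAction G A] [ContinuousSMul G A] (p : ℕ) :
    Cochain G A p →+ Cochain G A (p + 1) :=
  AddMonoidHom.mk' (dFun p) (dFun_add p)

/-- The coboundary is given almost everywhere by the usual formula. -/
theorem d_ae (p : ℕ) (φ : Cochain G A p) :
    d G A p φ =ᵐ[haarPow G (p + 1)] fun g =>
      g 0 • φ (Fin.tail g) +
        ∑ j : Fin (p + 1), (-1 : ℤ) ^ ((j : ℕ) + 1) • φ (Fin.contractNth j (· * ·) g) := by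
  have h1 := AEEqFun.coeFn_comp₂ (fun (g : G) (a : A) => g • a) continuous_smul (firstCoord G p)
    (φ.compQuasiMeasurePreserving _ quasiMeasurePreserving_tail)
  have h2 : firstCoord G p =ᵐ[haarPow G (p + 1)] fun g => g 0 := AEEqFun.coeFn_mk _ _
  have h3 := AEEqFun.coeFn_compQuasiMeasurePreserving φ (quasiMeasurePreserving_tail (G := G))
  have h4 : ∀ s : Finset (Fin (p + 1)),
      (∑ j ∈ s, (-1 : ℤ) ^ ((j : ℕ) + 1) •
        φ.compQuasiMeasurePreserving _ (quasiMeasurePreserving_contractNth j) :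
          Cochain G A (p + 1)) =ᵐ[haarPow G (p + 1)] fun g =>
        ∑ j ∈ s, (-1 : ℤ) ^ ((j : ℕ) + 1) • φ (Fin.contractNth j (· * ·) g) := by
    intro s
    induction s using Finset.induction_on with
    | empty =>
      simp only [Finset.sum_empty]
      exact AEEqFun.coeFn_zero
    | insert j s hj ih =>
      simp only [Finset.sum_insert hj]
      filter_upwards [ih, AEEqFun.coeFn_add ((-1 : ℤ) ^ ((j : ℕ) + 1) •
          φ.compQuasiMeasurePreserving _ (quasiMeasurePreserving_contractNth j))
          (∑ j ∈ s, (-1 : ℤ) ^ ((j : ℕ) + 1) •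
            φ.compQuasiMeasurePreserving _ (quasiMeasurePreserving_contractNth j)),
        AEEqFun.coeFn_smul ((-1 : ℤ) ^ ((j : ℕ) + 1))
          (φ.compQuasiMeasurePreserving _ (quasiMeasurePreserving_contractNth j)),
        AEEqFun.coeFn_compQuasiMeasurePreserving φ (quasiMeasurePreserving_contractNth j)]
        with g e1 e2 e3 e4
      rw [e2, Pi.add_apply, e1, e3, Pi.smul_apply, e4]
      rfl
  have h5 := AEEqFun.coeFn_add (AEEqFun.comp₂ (fun (g : G) (a : A) => g • a) continuous_smul
      (firstCoord G p) (φ.compQuasiMeasurePreserving _ quasiMeasurePreserving_tail))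
    (∑ j : Fin (p + 1), (-1 : ℤ) ^ ((j : ℕ) + 1) •
      φ.compQuasiMeasurePreserving _ (quasiMeasurePreserving_contractNth j))
  filter_upwards [h1, h2, h3, h4 Finset.univ, h5] with g e1 e2 e3 e4 e5
  refine Eq.trans e5 ?_
  rw [Pi.add_apply, e1, e2, e3, e4]
  rfl

/-! ### Cohomology -/

/-- The group `Z^p(G, A)` of measurable cocycles. -/
def cocycles (G : Type*) [Group G] [TopologicalSpace G] [IsTopologicalGroup G]
    [LocallyCompactSpace G] [MeasurableSpace G] [BorelSpace G] [SecondCountableTopology G]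
    [T2Space G] (A : Type*) [AddCommGroup A] [TopologicalSpace A] [IsTopologicalAddGroup A]
    [DistribMulAction G A] [ContinuousSMul G A] (p : ℕ) : AddSubgroup (Cochain G A p) :=
  (d G A p).ker

/-- The group `B^p(G, A)` of measurable coboundaries; it is trivial for `p = 0`. -/
def coboundaries (G : Type*) [Group G] [TopologicalSpace G] [IsTopologicalGroup G]
    [LocallyCompactSpace G] [MeasurableSpace G] [BorelSpace G] [SecondCountableTopology G]
    [T2Space G] (A : Type*) [AddCommGroup A] [TopologicalSpace A] [IsTopologicalAddGroup A]
    [DistribMulAction G A] [ContinuousSMul G A] : (p : ℕ) → AddSubgroup (Cochain G A p)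
  | 0 => ⊥
  | p + 1 => (d G A p).range

/-- The measurable cohomology group `H^p_m(G, A) = Z^p(G, A) / B^p(G, A)`. (Every coboundary is a
cocycle; `addSubgroupOf` regards `B^p(G, A)` as a subgroup of `Z^p(G, A)`.) -/
abbrev H (G : Type*) [Group G] [TopologicalSpace G] [IsTopologicalGroup G]
    [LocallyCompactSpace G] [MeasurableSpace G] [BorelSpace G] [SecondCountableTopology G]
    [T2Space G] (A : Type*) [AddCommGroup A] [TopologicalSpace A] [IsTopologicalAddGroup A]
    [DistribMulAction G A] [ContinuousSMul G A] (p : ℕ) : Type _ :=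
  cocycles G A p ⧸ (coboundaries G A p).addSubgroupOf (cocycles G A p)

/-! ### Functoriality in the module -/

variable {B : Type*} [AddCommGroup B] [TopologicalSpace B] [IsTopologicalAddGroup B]
  [DistribMulAction G B] [ContinuousSMul G B]

/-- The homomorphism on cochains `φ ↦ f ∘ φ` induced by a continuous homomorphism of modules. -/
def cochainMap (f : A →+[G] B) (hf : Continuous f) (p : ℕ) : Cochain G A p →+ Cochain G B p :=
  AddMonoidHom.mk' (fun φ => AEEqFun.comp f hf φ) fun φ ψ => by
    induction φ using AEEqFun.induction_on
    induction ψ using AEEqFun.induction_on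
    simp only [AEEqFun.mk_add_mk, AEEqFun.comp_mk]
    congr 1
    funext g
    simp

theorem cochainMap_d (f : A →+[G] B) (hf : Continuous f) (p : ℕ) (φ : Cochain G A p) :
    cochainMap f hf (p + 1) (d G A p φ) = d G B p (cochainMap f hf p φ) := by
  have h1 : ∀ (F : (Fin (p + 1) → G) →ₘ[haarPow G (p + 1)] G) (x : Cochain G A (p + 1)),
      cochainMap f hf (p + 1)
          (AEEqFun.comp₂ (fun (g : G) (a : A) => g • a) continuous_smul F x) =
        AEEqFun.comp₂ (fun (g : G) (b : B) => g • b) continuous_smul F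
          (cochainMap f hf (p + 1) x) := by
    intro F x
    induction F using AEEqFun.induction_on
    induction x using AEEqFun.induction_on
    rename_i F hF x hx
    refine Eq.trans (congrArg (AEEqFun.comp f hf) (AEEqFun.comp₂_mk_mk _ continuous_smul _ _ _ _))
      (Eq.trans ?_ (AEEqFun.comp₂_mk_mk _ continuous_smul _ _ _ _).symm)
    refine Eq.trans (AEEqFun.comp_mk _ hf _ _) ?_
    congr 1
    funext g
    exact map_smul f (F g) (x g)
  have h2 : ∀ (T : (Fin (p + 1) → G) → (Fin p → G))
      (hT : Measure.QuasiMeasurePreserving T (haarPow G (p + 1)) (haarPow G p)),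
      cochainMap f hf (p + 1) (φ.compQuasiMeasurePreserving T hT) =
        (cochainMap f hf p φ).compQuasiMeasurePreserving T hT := by
    intro T hT
    induction φ using AEEqFun.induction_on
    rfl
  simp only [d, AddMonoidHom.mk'_apply, dFun, map_add, map_sum, map_zsmul, h1, h2]

theorem cochainMap_mem_cocycles (f : A →+[G] B) (hf : Continuous f) (p : ℕ) (φ : cocycles G A p) :
    cochainMap f hf p φ ∈ cocycles G B p := by
  have h : d G A p φ = 0 := φ.2
  change d G B p _ = 0
  rw [← cochainMap_d, h, map_zero]

theorem cochainMap_mem_coboundaries (f : A →+[G] B) (hf : Continuous f) (p : ℕ)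
    (φ : Cochain G A p) (h : φ ∈ coboundaries G A p) :
    cochainMap f hf p φ ∈ coboundaries G B p := by
  cases p with
  | zero =>
    have h0 : φ = 0 := h
    rw [h0, map_zero]
    exact zero_mem _
  | succ p =>
    obtain ⟨ψ, rfl⟩ := h
    exact ⟨cochainMap f hf p ψ, (cochainMap_d f hf p ψ).symm⟩

/-- The homomorphism on cocycles induced by a continuous homomorphism of modules. -/
def cocycleMap (f : A →+[G] B) (hf : Continuous f) (p : ℕ) : cocycles G A p →+ cocycles G B p :=
  ((cochainMap f hf p).comp (cocycles G A p).subtype).codRestrict (cocycles G B p)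
    (cochainMap_mem_cocycles f hf p)

/-- The homomorphism `H^p_m(G, A) → H^p_m(G, B)` induced by a continuous homomorphism of modules:
the class of `φ` is sent to the class of `f ∘ φ`. -/
def H.map (f : A →+[G] B) (hf : Continuous f) (p : ℕ) : H G A p →+ H G B p :=
  QuotientAddGroup.map _ _ (cocycleMap f hf p) fun φ hφ =>
    cochainMap_mem_coboundaries f hf p φ hφ

end Cochains

/-! ### Submodules -/

/-- A `G`-submodule of `A`: an additive subgroup that is stable under the action of `G`. -/
structure GSubmodule (G : Type*) [Group G] (A : Type*) [AddCommGroup A] [DistribMulAction G A]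
    extends AddSubgroup A where
  smul_mem' : ∀ (g : G) {a : A}, a ∈ carrier → g • a ∈ carrier

namespace GSubmodule

variable {G : Type*} [Group G] {A : Type*} [AddCommGroup A] [DistribMulAction G A]

/-- The elements of a submodule, as a type. With the instances below it is a `G`-module; it carries
the subspace topology. -/
abbrev Elem (S : GSubmodule G A) : Type _ := S.toAddSubgroup

instance (S : GSubmodule G A) : DistribMulAction G S.Elem where
  smul g a := ⟨g • (a : A), S.smul_mem' g a.2⟩
  one_smul a := Subtype.ext (one_smul G (a : A))
  mul_smul g h a := Subtype.ext (mul_smul g h (a : A))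
  smul_zero g := Subtype.ext (smul_zero g)
  smul_add g a b := Subtype.ext (smul_add g (a : A) (b : A))

instance [TopologicalSpace G] [TopologicalSpace A] [ContinuousSMul G A] (S : GSubmodule G A) :
    ContinuousSMul G S.Elem where
  continuous_smul :=
    (continuous_fst.smul (continuous_subtype_val.comp continuous_snd)).subtype_mk _

/-- The inclusion of a submodule into the module. -/
def incl (S : GSubmodule G A) : S.Elem →+[G] A where
  toFun a := a
  map_smul' _ _ := rfl
  map_zero' := rfl
  map_add' _ _ := rfl

/-- The inclusion of a submodule into a larger submodule. -/
def inclusion {S T : GSubmodule G A} (h : S.toAddSubgroup ≤ T.toAddSubgroup) :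
    S.Elem →+[G] T.Elem where
  toFun a := ⟨a, h a.2⟩
  map_smul' _ _ := rfl
  map_zero' := rfl
  map_add' _ _ := rfl

theorem continuous_incl [TopologicalSpace A] (S : GSubmodule G A) : Continuous S.incl :=
  continuous_subtype_val

theorem continuous_inclusion [TopologicalSpace A] {S T : GSubmodule G A}
    (h : S.toAddSubgroup ≤ T.toAddSubgroup) : Continuous (inclusion h) :=
  continuous_subtype_val.subtype_mk _

end GSubmodule

/-! ### The direct limit -/

section DirectLimit

variable {G : Type*} [Group G] [TopologicalSpace G] [IsTopologicalGroup G] [LocallyCompactSpace G]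
  [MeasurableSpace G] [BorelSpace G] [SecondCountableTopology G] [T2Space G]
  {A : Type*} [AddCommGroup A] [TopologicalSpace A] [IsTopologicalAddGroup A]
  [DistribMulAction G A] [ContinuousSMul G A]

theorem H.map_inclusion_incl {S T : GSubmodule G A} (h : S.toAddSubgroup ≤ T.toAddSubgroup)
    (p : ℕ) (x : H G S.Elem p) :
    H.map T.incl T.continuous_incl p
        (H.map (GSubmodule.inclusion h) (GSubmodule.continuous_inclusion h) p x) =
      H.map S.incl S.continuous_incl p x := by
  induction x using QuotientAddGroup.induction_on with
  | _ z =>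
    obtain ⟨φ, hφ⟩ := z
    change QuotientAddGroup.mk _ = QuotientAddGroup.mk _
    congr 1
    apply Subtype.ext
    change cochainMap T.incl T.continuous_incl p (cochainMap (GSubmodule.inclusion h)
      (GSubmodule.continuous_inclusion h) p φ) = cochainMap S.incl S.continuous_incl p φ
    clear hφ
    induction φ using AEEqFun.induction_on
    rfl

variable {ι : Type*} [Preorder ι] [DecidableEq ι]

/-- The direct limit of the groups `H^p_m(G, A_m)` along the maps induced by the inclusions
`A_i ⊆ A_j` for `i ≤ j`. -/
abbrev limH (S : ι → GSubmodule G A) (hS : Monotone fun m => (S m).toAddSubgroup) (p : ℕ) :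
    Type _ :=
  AddCommGroup.DirectLimit (fun m => H G (S m).Elem p) fun _ _ hij =>
    H.map (GSubmodule.inclusion (hS hij)) (GSubmodule.continuous_inclusion (hS hij)) p

/-- The homomorphism from the direct limit of the groups `H^p_m(G, A_m)` to `H^p_m(G, A)` whose
restriction to each `H^p_m(G, A_m)` is induced by the inclusion `A_m ⊆ A`. -/
def limHToH (S : ι → GSubmodule G A) (hS : Monotone fun m => (S m).toAddSubgroup) (p : ℕ) :
    limH S hS p →+ H G A p :=
  AddCommGroup.DirectLimit.lift _ _ (H G A p)
    (fun m => H.map (S m).incl (S m).continuous_incl p)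
    fun _ _ hij x => H.map_inclusion_incl (hS hij) p x

end DirectLimit

end MeasurableCohomology

end

noncomputable section

namespace MeasurableCohomology

/-! ### Partial coboundaries -/

section Faces

variable {G : Type*} [Group G] {A : Type*} [AddCommGroup A] [DistribMulAction G A]

/-! Both injectivity and surjectivity reduce to one statement (`exists_sub_mem_of_d_mem`): if `dφ`
has values in some `A_i`, then `φ` differs by a coboundary from a cochain with values in some `A_m`,
`m ≥ i`. Surjectivity is the case `dφ = 0`. For injectivity, if `φ = dψ` over `A`, replacing `ψ` by
`ψ - β` with `β` a coboundary does not change `dψ`.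

Since `G` is compact, Haar measure can be normalized to a probability measure, and a measurable map
to a discrete module has countably many values up to the choice made by strong measurability. Hence
`φ` lies in some `S = A_m` outside a set of measure as small as desired. It remains to see that a
cocycle modulo `S` which is in `S` off a small set is a coboundary modulo `S`
(`exists_sub_partialD_mem`).

This is done one face of the coboundary at a time. Split `df` into the faces of index at most `k`
(`partialD k f`) and the others (`partialE k f`); modulo `S` one is small exactly when the other is.
Substituting `(…, s, s⁻¹ z_k, …)` for `z` turns the first face of `partialE k f` into `f z` and the
others into faces of a cochain `e` in one variable fewer. An averaging argument chooses `s` as a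
measurable function of the first `k` coordinates so that exceptional sections stay small; thus `f -
partialE k e` is in `S` up to small sections. As `partialD (k + 1) ∘ partialD k = 0`, `partialD (k +
1) (f - de)` is an alternating sum of `k + 2` faces of `f - partialE k e`, so it too has small
sections, with the bound multiplied by `k + 2`.

When only the last face is left over, its value depends only on the fixed coordinates: its
exceptional sections have measure 0 or 1, and a bound below 1 forces 0. -/

/-- `(g₀, …, g_N) ↦ (g₀, …, g_j g_{j+1}, …, g_N)`, or dropping the last coordinate if `N ≤ j`. -/
def contract (j : ℕ) {N : ℕ} (g : Fin (N + 1) → G) : Fin N → G := fun m =>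
  if (m : ℕ) < j then g m.castSucc else if (m : ℕ) = j then g m.castSucc * g m.succ else g m.succ

theorem contract_eq_contractNth {N : ℕ} (j : Fin (N + 1)) (g : Fin (N + 1) → G) :
    contract j g = Fin.contractNth j (· * ·) g := rfl

/-- The terms of the coboundary of a function of `N` variables, without signs. -/
def face (i : ℕ) {N : ℕ} (f : (Fin N → G) → A) (g : Fin (N + 1) → G) : A :=
  match i with
  | 0 => g 0 • f (Fin.tail g)
  | i + 1 => f (contract i g)

/-- The alternating sum of the faces with index at most `k`. -/
def partialD (k : ℕ) {N : ℕ} (f : (Fin N → G) → A) (g : Fin (N + 1) → G) : A :=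
  ∑ i ∈ Finset.range (k + 1), (-1 : ℤ) ^ i • face i f g

/-- The alternating sum of the faces of a function of `N` variables with index more than `k`. -/
def partialE (k : ℕ) {N : ℕ} (f : (Fin N → G) → A) (g : Fin (N + 1) → G) : A :=
  ∑ i ∈ Finset.Ico (k + 1) (N + 2), (-1 : ℤ) ^ i • face i f g

theorem partialD_add_partialE {k N : ℕ} (hk : k ≤ N + 1) (f : (Fin N → G) → A)
    (g : Fin (N + 1) → G) : partialD k f g + partialE k f g = partialD (N + 1) f g :=
  Finset.sum_range_add_sum_Ico _ (by omega)

theorem contract_contract {i j : ℕ} (h : i ≤ j) {N : ℕ} (g : Fin (N + 2) → G) :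
    contract j (contract i g) = contract i (contract (j + 1) g) := by
  funext m
  simp only [contract, Fin.val_castSucc, Fin.val_succ]
  split_ifs <;> first | rfl | omega | exact mul_assoc _ _ _

theorem tail_contract_zero {N : ℕ} (g : Fin (N + 2) → G) :
    Fin.tail (contract 0 g) = Fin.tail (Fin.tail g) := by
  funext m
  simp [contract, Fin.tail]

theorem tail_contract_succ (j : ℕ) {N : ℕ} (g : Fin (N + 2) → G) :
    Fin.tail (contract (j + 1) g) = contract j (Fin.tail g) := by
  funext m
  simp only [contract, Fin.tail, Fin.val_succ, add_lt_add_iff_right, add_left_inj]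
  rfl

theorem face_face {i j : ℕ} (h : i ≤ j) {N : ℕ} (f : (Fin N → G) → A) :
    face i (face j f) = face (j + 1) (face i f) := by
  funext g
  rcases i with _ | i <;> rcases j with _ | j
  · simp only [face, tail_contract_zero]
    simp [contract, Fin.tail, mul_smul]
  · simp only [face, tail_contract_succ]
    simp [contract]
  · omega
  · simp only [face]
    rw [contract_contract (by omega)]

/-- The terms at `(i, j)` with `i ≤ j` and at `(j + 1, i)` cancel. The rectangle `i ≤ k`, `j < k` is
a union of such pairs, which is why `d ∘ d = 0` survives truncation in `partialD_partialD`. -/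
theorem alternating_sum_eq_zero {M : Type*} [AddCommGroup M] (a : ℕ → ℕ → M)
    (h : ∀ i j, i ≤ j → a i j = a (j + 1) i) (k : ℕ) :
    ∑ i ∈ Finset.range (k + 1), (-1 : ℤ) ^ i • ∑ j ∈ Finset.range k, (-1 : ℤ) ^ j • a i j = 0 := by
  induction k with
  | zero => simp
  | succ k ih =>
    have h1 : ∀ i, ∑ j ∈ Finset.range (k + 1), (-1 : ℤ) ^ j • a i j =
        ∑ j ∈ Finset.range k, (-1 : ℤ) ^ j • a i j + (-1 : ℤ) ^ k • a i k :=
      fun i => Finset.sum_range_succ _ _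
    rw [Finset.sum_range_succ]
    simp only [h1 _, smul_add, Finset.sum_add_distrib]
    rw [ih, zero_add, ← smul_add, ← h1, Finset.smul_sum, ← Finset.sum_add_distrib]
    refine Finset.sum_eq_zero fun i hi => ?_
    rw [h i k (by simpa [Nat.lt_succ_iff] using hi), smul_smul, smul_smul, ← add_smul]
    rw [pow_succ]
    ring_nf
    simp

theorem face_zsmul (i : ℕ) {N : ℕ} (c : ℤ) (f : (Fin N → G) → A) :
    face i (c • f) = c • face i f := by
  funext g
  rcases i with _ | i
  · exact smul_comm (g 0) c (f (Fin.tail g))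
  · rfl

theorem face_add (i : ℕ) {N : ℕ} (f f' : (Fin N → G) → A) :
    face i (f + f') = face i f + face i f' := by
  funext g
  rcases i with _ | i
  · simp [face]
  · rfl

theorem face_sum (i : ℕ) {N : ℕ} {ι : Type*} (s : Finset ι) (f : ι → (Fin N → G) → A) :
    face i (∑ x ∈ s, f x) = ∑ x ∈ s, face i (f x) := by
  funext g
  rcases i with _ | i
  · simp [face, Finset.smul_sum]
  · simp [face]

theorem partialD_eq_sum (k : ℕ) {N : ℕ} (f : (Fin N → G) → A) :
    partialD k f = ∑ i ∈ Finset.range (k + 1), (-1 : ℤ) ^ i • face i f := by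
  funext g
  simp [partialD]

theorem partialD_add (k : ℕ) {N : ℕ} (f f' : (Fin N → G) → A) :
    partialD k (f + f') = partialD k f + partialD k f' := by
  simp only [partialD_eq_sum, face_add, smul_add, Finset.sum_add_distrib]

theorem partialD_zsmul (k : ℕ) {N : ℕ} (c : ℤ) (f : (Fin N → G) → A) :
    partialD k (c • f) = c • partialD k f := by
  simp only [partialD_eq_sum, face_zsmul, Finset.smul_sum, smul_comm c]

theorem partialD_sub (k : ℕ) {N : ℕ} (f f' : (Fin N → G) → A) :
    partialD k (f - f') = partialD k f - partialD k f' := by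
  have := partialD_add k f ((-1 : ℤ) • f')
  rw [partialD_zsmul] at this
  simpa [sub_eq_add_neg] using this

theorem partialD_partialD (k : ℕ) {N : ℕ} (f : (Fin N → G) → A) :
    partialD (k + 1) (partialD k f) = 0 := by
  have := alternating_sum_eq_zero (fun i j => face i (face j f)) (fun i j h => face_face h f) (k + 1)
  rw [partialD_eq_sum, partialD_eq_sum]
  simpa only [face_sum, face_zsmul] using this

/-! ### Gluing and inserting coordinates -/

/-- The `i`-th coordinate of `y`, or `1` if there is none. -/
def coord {N : ℕ} (y : Fin N → G) (i : ℕ) : G := if h : i < N then y ⟨i, h⟩ else 1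

/-- The first `k` coordinates. -/
def trunc (k : ℕ) {N : ℕ} (y : Fin N → G) : Fin k → G := fun m => coord y m

/-- Replace the first `k` coordinates of `y` by those of `u`. -/
def glue {k N : ℕ} (u : Fin k → G) (y : Fin N → G) : Fin N → G := fun m =>
  if h : (m : ℕ) < k then u ⟨m, h⟩ else y m

/-- `(y₀, …, y_{N-1}) ↦ (y₀, …, y_{k-1}, s, s⁻¹ y_k, y_{k+1}, …)`. -/
def insertAt (k : ℕ) {N : ℕ} (s : G) (y : Fin N → G) : Fin (N + 1) → G := fun m =>
  if (m : ℕ) < k then coord y m else if (m : ℕ) = k then s else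
    if (m : ℕ) = k + 1 then s⁻¹ * coord y k else coord y (m - 1)

theorem coord_val {N : ℕ} (y : Fin N → G) (m : Fin N) : coord y m = y m := by
  simp [coord]

theorem coord_contract {j N i : ℕ} (hi : i < N) (y : Fin (N + 1) → G) :
    coord (contract j y) i = if i < j then coord y i else
      if i = j then coord y i * coord y (i + 1) else coord y (i + 1) := by
  have h1 : i < N + 1 := hi.trans (Nat.lt_succ_self N)
  have h2 : i + 1 < N + 1 := Nat.succ_lt_succ hi
  simp only [coord, hi, h1, h2, dif_pos]
  rfl

theorem coord_insertAt {k N i : ℕ} (hi : i < N + 1) (s : G) (y : Fin N → G) :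
    coord (insertAt k s y) i = if i < k then coord y i else if i = k then s else
      if i = k + 1 then s⁻¹ * coord y k else coord y (i - 1) := by
  simp only [coord, hi, dif_pos]
  rfl

theorem contract_insertAt_self {k N : ℕ} (s : G) (y : Fin N → G) :
    contract k (insertAt k s y) = y := by
  funext m
  have hm := m.2
  rw [← coord_val (contract _ _), ← coord_val y, coord_contract hm, coord_insertAt (by omega),
    coord_insertAt (by omega)]
  generalize (m : ℕ) = i
  rcases lt_trichotomy i k with h1 | rfl | h1
  · simp [h1]
  · simp
  · simp [h1.not_gt, h1.ne', (show i + 1 ≠ k by omega), (show ¬ i + 1 < k by omega)]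

theorem contract_insertAt {k j N : ℕ} (hk : k ≤ N) (h : k ≤ j) (s : G) (y : Fin (N + 1) → G) :
    contract (j + 1) (insertAt k s y) = insertAt k s (contract j y) := by
  funext m
  have hm := m.2
  rw [← coord_val (contract _ _), ← coord_val (insertAt _ _ _), coord_contract hm,
    coord_insertAt (by omega), coord_insertAt (by omega), coord_insertAt (by omega)]
  generalize (m : ℕ) = i at hm
  rcases lt_trichotomy i k with h1 | rfl | h1
  · rw [coord_contract (by omega)]
    simp [h1, (show i < j by omega), (show i < j + 1 by omega)]
  · simp [(show i < j + 1 by omega)]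
  · obtain ⟨i, rfl⟩ := Nat.exists_eq_add_of_lt h1
    rw [coord_contract (show k + i + 1 - 1 < N by omega), Nat.add_sub_cancel, Nat.add_sub_cancel]
    simp only [(show ¬ k + i + 1 < k by omega), (show k + i + 1 ≠ k by omega),
      (show ¬ k + i + 1 + 1 < k by omega), (show k + i + 1 + 1 ≠ k by omega),
      (show k + i + 1 + 1 ≠ k + 1 by omega), add_lt_add_iff_right, add_left_inj, if_false]
    rcases Nat.eq_zero_or_pos i with rfl | h2
    · rw [coord_contract (by omega)]
      simp only [add_zero, if_true]
      split_ifs <;> first | omega | simp [mul_assoc]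
    · simp [h2.ne']

theorem glue_insertAt {k N : ℕ} (hk : k ≤ N) (u : Fin k → G) (s : G) (y : Fin N → G) :
    glue u (insertAt k s y) = insertAt k s (glue u y) := by
  funext m
  have hm := m.2
  simp only [glue, insertAt, coord]
  split_ifs <;> first | rfl | omega

theorem trunc_glue {k N : ℕ} (hk : k ≤ N) (u : Fin k → G) (y : Fin N → G) :
    trunc k (glue u y) = u := by
  funext m
  have hm := m.2
  simp only [trunc, glue, coord]
  split_ifs <;> first | rfl | omega

theorem trunc_contract {k j N : ℕ} (hk : k ≤ N) (h : k ≤ j) (y : Fin (N + 1) → G) :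
    trunc k (contract j y) = trunc k y := by
  funext m
  have hm := m.2
  simp only [trunc, contract, coord]
  split_ifs <;> first | rfl | omega

omit [Group G] in
theorem tail_glue {k N : ℕ} (u : Fin (k + 1) → G) (y : Fin (N + 1) → G) :
    Fin.tail (glue u y) = glue (Fin.tail u) (Fin.tail y) := by
  funext m
  simp only [Fin.tail, glue, Fin.val_succ, add_lt_add_iff_right]
  rfl

/-- With `u` fixed, a contraction acts on the free coordinates as `Fin.tail` followed by a left
translation. The translation is visible only for `j = k`, where `u_k` multiplies the first free
coordinate; for `j < k` the gluing overwrites it. -/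
theorem contract_glue {j k N : ℕ} (h : j ≤ k) (u : Fin (k + 1) → G) (y : Fin (N + 1) → G) :
    contract j (glue u y) =
      glue (contract j u) ((fun m : Fin N => if (m : ℕ) = j then coord u j else 1) * Fin.tail y) := by
  funext m
  simp only [contract, glue, coord, Fin.val_castSucc, Fin.val_succ, Fin.tail, Pi.mul_apply]
  split_ifs <;> first | rfl | omega | simp_all

/-- The face of index `k + 1` multiplies `s` by `s⁻¹ z_k` and returns `f z`. The later faces commute
with the insertion and do not touch the first `k` coordinates, on which `τ` depends, so they become
faces of the function with the coordinate inserted, with index lowered by one and sign reversed. -/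
theorem partialE_insertAt {k N : ℕ} (hk : k ≤ N) (f : (Fin (N + 1) → G) → A)
    (τ : (Fin k → G) → G) (z : Fin (N + 1) → G) :
    partialE k f (insertAt k (τ (trunc k z)) z) = (-1 : ℤ) ^ (k + 1) •
      (f z - partialE k ((-1 : ℤ) ^ (k + 1) • fun w => f (insertAt k (τ (trunc k w)) w)) z) := by
  have h1 : ((-1 : ℤ) ^ (k + 1)) * ((-1 : ℤ) ^ (k + 1)) = 1 := by
    rw [← mul_pow]; simp
  simp only [partialE, face_zsmul, Pi.smul_apply, smul_sub, Finset.smul_sum, smul_smul]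
  rw [Finset.sum_eq_sum_Ico_succ_bot (by omega), Finset.sum_Ico_eq_sum_range,
    Finset.sum_Ico_eq_sum_range, sub_eq_add_neg, ← Finset.sum_neg_distrib]
  have h2 : N + 1 + 2 - (k + 1 + 1) = N + 2 - (k + 1) := by omega
  rw [h2]
  congr 1
  · simp only [face]
    rw [contract_insertAt_self]
  · refine Finset.sum_congr rfl fun i _ => ?_
    have h3 : k + 1 + 1 + i = (k + i + 1) + 1 := by ring
    have h4 : k + 1 + i = k + i + 1 := by ring
    rw [h3, h4]
    simp only [face]
    rw [contract_insertAt hk (by omega), trunc_contract hk (by omega), mul_comm _ ((-1 : ℤ) ^ (k + 1)),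
      ← mul_assoc, h1, one_mul, ← neg_smul, pow_succ _ (k + i + 1)]
    simp

theorem partialE_last {N : ℕ} (f : (Fin N → G) → A) (g : Fin (N + 1) → G) :
    partialE N f g = (-1 : ℤ) ^ (N + 1) • f (Fin.init g) := by
  simp only [partialE, Nat.Ico_succ_singleton, Finset.sum_singleton, face]
  congr 2
  funext m
  simp [contract, Fin.init]

end Faces

/-! ### Measurability and invariance of the coordinate maps -/

section MeasurableMaps

variable {G : Type*} [Group G] [MeasurableSpace G]

theorem measurable_coord {N : ℕ} (i : ℕ) : Measurable fun y : Fin N → G => coord y i := by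
  unfold coord
  split_ifs with h
  · exact measurable_pi_apply _
  · exact measurable_const

theorem measurable_trunc (k : ℕ) {N : ℕ} : Measurable (trunc k : (Fin N → G) → Fin k → G) :=
  measurable_pi_lambda _ fun _ => measurable_coord _

omit [Group G] in
theorem measurable_glue {k N : ℕ} :
    Measurable fun q : (Fin k → G) × (Fin N → G) => glue q.1 q.2 := by
  refine measurable_pi_lambda _ fun m => ?_
  unfold glue
  split_ifs with h
  · exact (measurable_pi_apply _).comp measurable_fst
  · exact (measurable_pi_apply _).comp measurable_snd

omit [Group G] in
theorem measurable_glue_left {k N : ℕ} (u : Fin k → G) :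
    Measurable (glue u : (Fin N → G) → Fin N → G) :=
  measurable_glue.comp measurable_prodMk_left

omit [Group G] in
theorem measurable_tail {N : ℕ} : Measurable (Fin.tail : (Fin (N + 1) → G) → Fin N → G) :=
  measurable_pi_lambda _ fun _ => measurable_pi_apply _

theorem measurable_contract [MeasurableMul₂ G] (j : ℕ) {N : ℕ} :
    Measurable (contract j : (Fin (N + 1) → G) → Fin N → G) := by
  refine measurable_pi_lambda _ fun m => ?_
  unfold contract
  split_ifs with h h
  · exact measurable_pi_apply _
  · exact (measurable_pi_apply _).mul (measurable_pi_apply _)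
  · exact measurable_pi_apply _

theorem measurable_insertAt [MeasurableMul₂ G] [MeasurableInv G] (k : ℕ) {N : ℕ} :
    Measurable fun q : G × (Fin N → G) => insertAt k q.1 q.2 := by
  refine measurable_pi_lambda _ fun m => ?_
  unfold insertAt
  split_ifs with h h
  · exact (measurable_coord _).comp measurable_snd
  · exact measurable_fst
  · exact measurable_fst.inv.mul ((measurable_coord _).comp measurable_snd)
  · exact (measurable_coord _).comp measurable_snd

variable (ν : Measure G) [IsProbabilityMeasure ν]

/-- The product measure on `G ^ N`. -/
abbrev powMeasure {G : Type*} [MeasurableSpace G] (ν : Measure G) (N : ℕ) : Measure (Fin N → G) :=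
  Measure.pi fun _ => ν

omit [Group G] in
theorem measurePreserving_tail (N : ℕ) :
    MeasurePreserving (Fin.tail : (Fin (N + 1) → G) → Fin N → G) (powMeasure ν (N + 1))
      (powMeasure ν N) :=
  (measurePreserving_snd (μ := ν) (ν := powMeasure ν N)).comp
    (measurePreserving_piFinSuccAbove (fun _ : Fin (N + 1) => ν) 0)

-- The first `k` coordinates of the second argument are dummies that integrate to 1. Keeping them
-- lets sections be measured in `G ^ N` without splitting it as `G ^ k × G ^ (N - k)`.
omit [Group G] in
theorem measurePreserving_glue {k N : ℕ} (hk : k ≤ N) :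
    MeasurePreserving (fun q : (Fin k → G) × (Fin N → G) => glue q.1 q.2)
      ((powMeasure ν k).prod (powMeasure ν N)) (powMeasure ν N) := by
  refine ⟨measurable_glue, (Measure.pi_eq fun s hs => ?_).symm⟩
  rw [Measure.map_apply measurable_glue (MeasurableSet.univ_pi hs)]
  have h1 : (fun q : (Fin k → G) × (Fin N → G) => glue q.1 q.2) ⁻¹' Set.univ.pi s =
      (Set.univ.pi fun m : Fin k => s (m.castLE hk)) ×ˢ
        (Set.univ.pi fun m : Fin N => if (m : ℕ) < k then Set.univ else s m) := by
    ext ⟨u, y⟩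
    simp only [Set.mem_preimage, Set.mem_pi, Set.mem_univ, true_implies, Set.mem_prod, glue]
    constructor
    · refine fun h => ⟨fun m => ?_, fun m => ?_⟩
      · have := h (m.castLE hk)
        simpa using this
      · split_ifs with hm
        · trivial
        · simpa [hm] using h m
    · rintro ⟨h, h'⟩ m
      split_ifs with hm
      · exact h ⟨m, hm⟩
      · simpa [hm] using h' m
  rw [h1, Measure.prod_prod, Measure.pi_pi, Measure.pi_pi]
  have h2 : ∏ m : Fin k, ν (s (m.castLE hk)) =
      ∏ m : Fin N, if (m : ℕ) < k then ν (s m) else 1 := by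
    rw [← Finset.prod_filter]
    refine Finset.prod_bij (fun m _ => m.castLE hk) (by simp) (by simp) (fun m hm => ?_) (by simp)
    have hm' : (m : ℕ) < k := by simpa using hm
    exact ⟨⟨m, hm'⟩, by simp, rfl⟩
  rw [h2, ← Finset.prod_mul_distrib]
  refine Finset.prod_congr rfl fun m _ => ?_
  split_ifs <;> simp

variable [MeasurableMul₂ G] [ν.IsMulLeftInvariant]

theorem measurePreserving_contractNth {N : ℕ} (j : Fin (N + 1)) :
    MeasurePreserving (contract (j : ℕ) : (Fin (N + 1) → G) → Fin N → G) (powMeasure ν (N + 1))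
      (powMeasure ν N) := by
  have h1 := measurePreserving_piFinSuccAbove (fun _ : Fin (N + 1) => ν) j
  have hc : Measurable fun x : G => (fun m : Fin N => if (m : ℕ) = j then x else 1) := by
    refine measurable_pi_lambda _ fun m => ?_
    split_ifs
    · exact measurable_id
    · exact measurable_const
  have h2 := (MeasurePreserving.id ν).skew_product (μc := powMeasure ν N) (μd := powMeasure ν N)
    (g := fun x y => (fun m : Fin N => if (m : ℕ) = j then x else 1) * y)
    ((hc.comp measurable_fst).mul measurable_snd)
    (Filter.Eventually.of_forall fun x => map_mul_left_eq_self (powMeasure ν N) _)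
  have h3 := (measurePreserving_snd.comp h2).comp h1
  convert h3 using 1
  funext g
  rw [contract_eq_contractNth, contractNth_eq]
  rfl

/-- The map is a shear, translating the coordinate `k` by `s⁻¹`, followed by placing `s` at position
`k`. For `k = N` there is no coordinate to translate. -/
theorem measurePreserving_insertAt [MeasurableInv G] {k N : ℕ} (hk : k ≤ N) :
    MeasurePreserving (fun q : G × (Fin N → G) => insertAt k q.1 q.2) (ν.prod (powMeasure ν N))
      (powMeasure ν (N + 1)) := by
  have h1 := (measurePreserving_piFinSuccAbove (fun _ : Fin (N + 1) => ν) ⟨k, by omega⟩).symm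
  have hc : Measurable fun x : G => (fun m : Fin N => if (m : ℕ) = k then x⁻¹ else 1) := by
    refine measurable_pi_lambda _ fun m => ?_
    split_ifs
    · exact measurable_inv
    · exact measurable_const
  have h2 := (MeasurePreserving.id ν).skew_product (μc := powMeasure ν N) (μd := powMeasure ν N)
    (g := fun x y => (fun m : Fin N => if (m : ℕ) = k then x⁻¹ else 1) * y)
    ((hc.comp measurable_fst).mul measurable_snd)
    (Filter.Eventually.of_forall fun x => map_mul_left_eq_self (powMeasure ν N) _)
  have h3 := h1.comp h2
  convert h3 using 1
  funext q
  obtain ⟨s, y⟩ := q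
  refine Fin.eq_insertNth_iff.2 ⟨?_, ?_⟩
  · simp [insertAt]
  · funext m
    have hm := m.2
    simp only [Fin.removeNth, insertAt, Pi.mul_apply]
    rcases lt_trichotomy (m : ℕ) k with h | h | h
    · rw [Fin.succAbove_of_castSucc_lt _ _ (by simpa [Fin.lt_def] using h)]
      simp [h, h.ne, coord_val]
    · rw [Fin.succAbove_of_le_castSucc _ _ (by simp [Fin.le_def, h])]
      simp [h, ← coord_val y]
    · rw [Fin.succAbove_of_le_castSucc _ _ (by simp [Fin.le_def, h.le])]
      simp [h.ne', coord_val, (show ¬ (m : ℕ) + 1 < k by omega), (show (m : ℕ) + 1 ≠ k by omega)]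

end MeasurableMaps

/-! ### Measurable selection -/

/-- Sample an independent sequence from `ν`. For almost every `x`, the first `n` samples all miss
the section with probability `(1 - ν V_x) ^ n → 0`, so almost surely one of them hits. By Fubini a
single sequence works for almost every `x`, and `τ x` is its first term in the section. No
regularity of `X` or `Y` is needed. -/
theorem exists_measurable_selection {X Y : Type*} [MeasurableSpace X] [MeasurableSpace Y]
    (μ : Measure X) [SFinite μ] (ν : Measure Y) [IsProbabilityMeasure ν] {V : Set (X × Y)}
    (hV : MeasurableSet V) (h : ∀ᵐ x ∂μ, 0 < ν (Prod.mk x ⁻¹' V)) :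
    ∃ τ : X → Y, Measurable τ ∧ ∀ᵐ x ∂μ, (x, τ x) ∈ V := by
  classical
  have hm : ∀ n : ℕ, MeasurableSet {q : X × (ℕ → Y) | (q.1, q.2 n) ∈ V} := fun n =>
    (measurable_fst.prodMk ((measurable_pi_apply n).comp measurable_snd)) hV
  have h1 : ∀ᵐ x ∂μ, ∀ᵐ s ∂Measure.infinitePi (fun _ : ℕ => ν), ∃ n, (x, s n) ∈ V := by
    filter_upwards [h] with x hx
    have hVx : MeasurableSet (Prod.mk x ⁻¹' V) := measurable_prodMk_left hV
    have hlt : ν (Prod.mk x ⁻¹' V)ᶜ < 1 := by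
      rw [prob_compl_eq_one_sub hVx]
      exact ENNReal.sub_lt_self ENNReal.one_ne_top one_ne_zero hx.ne'
    rw [ae_iff, ← nonpos_iff_eq_zero]
    refine ge_of_tendsto' (ENNReal.tendsto_pow_atTop_nhds_zero_of_lt_one hlt) fun n => ?_
    have h2 := Measure.infinitePi_pi (fun _ : ℕ => ν) (s := Finset.range n)
      (t := fun _ => (Prod.mk x ⁻¹' V)ᶜ) fun _ _ => hVx.compl
    rw [Finset.prod_const, Finset.card_range] at h2
    rw [← h2]
    refine measure_mono fun s hs i _ hi => hs ⟨i, hi⟩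
  have h3 : ∀ᵐ s ∂Measure.infinitePi (fun _ : ℕ => ν), ∀ᵐ x ∂μ, ∃ n, (x, s n) ∈ V := by
    have hU : MeasurableSet {q : X × (ℕ → Y) | ∃ n, (q.1, q.2 n) ∈ V} := by
      simp only [Set.ofPred_exists]
      exact MeasurableSet.iUnion hm
    exact (Measure.ae_ae_comm hU).1 h1
  obtain ⟨s, hs⟩ := h3.exists
  obtain ⟨y⟩ : Nonempty Y := nonempty_of_isProbabilityMeasure ν
  let T : Set X := {x | ∃ n, (x, s n) ∈ V}
  have hsec : ∀ n, MeasurableSet {x | (x, s n) ∈ V} := fun n =>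
    (measurable_id.prodMk measurable_const) hV
  have hT : MeasurableSet T := by
    simp only [T, Set.ofPred_exists]
    exact MeasurableSet.iUnion hsec
  -- The clause `x ∉ T` makes the search terminate on the null set where no term hits.
  let p : X → ℕ → Prop := fun x n => (x, s n) ∈ V ∨ x ∉ T
  have hp : ∀ x, ∃ n, p x n := fun x => by
    by_cases hx : x ∈ T
    · obtain ⟨n, hn⟩ := hx
      exact ⟨n, Or.inl hn⟩
    · exact ⟨0, Or.inr hx⟩
  refine ⟨fun x => s (Nat.find (hp x)), (measurable_from_top (f := s)).comp
    (measurable_find hp fun n => (hsec n).union hT.compl), ?_⟩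
  filter_upwards [hs] with x hx
  exact (Nat.find_spec (hp x)).resolve_right fun h => h hx

/-! ### Sets with small sections -/

section SmallSections

variable {G : Type*} [Group G] [MeasurableSpace G]

/-- For almost every choice of the first `k` coordinates, the section of `W` in the other
coordinates has measure at most `η`. -/
def SmallSections (ν : Measure G) (k : ℕ) (η : ENNReal) {N : ℕ} (W : Set (Fin N → G)) : Prop :=
  ∀ᵐ u ∂powMeasure ν k, powMeasure ν N {y | glue u y ∈ W} ≤ η

variable {ν : Measure G} [IsProbabilityMeasure ν] {k N : ℕ} {η : ENNReal}

omit [Group G] [IsProbabilityMeasure ν] in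
theorem SmallSections.mono {W W' : Set (Fin N → G)} (h : SmallSections ν k η W) (hW : W' ⊆ W) :
    SmallSections ν k η W' := by
  filter_upwards [h] with u hu
  exact le_trans (measure_mono (Set.preimage_mono hW)) hu

omit [Group G] in
theorem ae_ae_glue (hk : k ≤ N) {p : (Fin N → G) → Prop} (hp : ∀ᵐ g ∂powMeasure ν N, p g) :
    ∀ᵐ u ∂powMeasure ν k, ∀ᵐ y ∂powMeasure ν N, p (glue u y) :=
  Measure.ae_ae_of_ae_prod ((measurePreserving_glue ν hk).quasiMeasurePreserving.ae hp)

omit [Group G] in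
theorem SmallSections.congr_ae (hk : k ≤ N) {W W' : Set (Fin N → G)} (h : SmallSections ν k η W)
    (hW : ∀ᵐ g ∂powMeasure ν N, g ∈ W' → g ∈ W) : SmallSections ν k η W' := by
  filter_upwards [h, ae_ae_glue hk hW] with u hu hu'
  exact (measure_mono_ae hu').trans hu

omit [Group G] [IsProbabilityMeasure ν] in
theorem SmallSections.biUnion {ι : Type*} (s : Finset ι) {W : ι → Set (Fin N → G)}
    (h : ∀ i ∈ s, SmallSections ν k η (W i)) :
    SmallSections ν k (s.card * η) (⋃ i ∈ s, W i) := by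
  have h' : ∀ᵐ u ∂powMeasure ν k, ∀ i ∈ s, powMeasure ν N {y | glue u y ∈ W i} ≤ η :=
    (ae_ball_iff s.countable_toSet).2 h
  filter_upwards [h'] with u hu
  have h1 : {y | glue u y ∈ ⋃ i ∈ s, W i} = ⋃ i ∈ s, {y | glue u y ∈ W i} := by
    ext y
    simp
  rw [h1]
  refine (measure_biUnion_finset_le s _).trans ((Finset.sum_le_sum hu).trans ?_)
  simp

omit [Group G] in
theorem SmallSections.tail_preimage {W : Set (Fin N → G)} (hW : MeasurableSet W)
    (h : SmallSections ν k η W) :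
    SmallSections ν (k + 1) η ((Fin.tail : (Fin (N + 1) → G) → Fin N → G) ⁻¹' W) := by
  filter_upwards [(measurePreserving_tail ν k).quasiMeasurePreserving.ae h] with u hu
  refine le_of_eq_of_le ?_ hu
  have hm : MeasurableSet {y : Fin N → G | glue (Fin.tail u) y ∈ W} :=
    (measurable_glue_left _) hW
  rw [← (measurePreserving_tail ν N).measure_preimage hm.nullMeasurableSet]
  simp only [Set.mem_preimage, tail_glue]
  rfl

/-- For `j ≤ k`, `contract_glue` exhibits the section over `u` as the preimage of the section over
`contract j u` under a measure preserving map, and `u ↦ contract j u` preserves null sets under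
preimage. -/
theorem SmallSections.contract_preimage [MeasurableMul₂ G] [ν.IsMulLeftInvariant]
    {W : Set (Fin N → G)} (hW : MeasurableSet W) (h : SmallSections ν k η W) {j : ℕ} (hj : j ≤ k) :
    SmallSections ν (k + 1) η ((contract j : (Fin (N + 1) → G) → Fin N → G) ⁻¹' W) := by
  filter_upwards [(measurePreserving_contractNth ν
    (⟨j, Nat.lt_succ_of_le hj⟩ : Fin (k + 1))).quasiMeasurePreserving.ae h] with u hu
  refine le_of_eq_of_le ?_ hu
  have hm : MeasurableSet {y : Fin N → G | glue (contract j u) y ∈ W} :=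
    (measurable_glue_left _) hW
  have h1 := (measurePreserving_mul_left (powMeasure ν N)
    (fun m : Fin N => if (m : ℕ) = j then coord u j else 1)).comp (measurePreserving_tail ν N)
  rw [← h1.measure_preimage hm.nullMeasurableSet]
  simp only [Set.mem_preimage, contract_glue hj]
  rfl

/-- If the sections of `W` are small, then a new coordinate can be inserted, as a measurable
function of the first `k` coordinates, in such a way that the sections stay small. -/
theorem SmallSections.exists_insertAt [MeasurableMul₂ G] [MeasurableInv G] [ν.IsMulLeftInvariant]
    (hk : k ≤ N) {W : Set (Fin (N + 1) → G)} (hW : MeasurableSet W) (h : SmallSections ν k η W) :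
    ∃ τ : (Fin k → G) → G, Measurable τ ∧
      SmallSections ν k η {z : Fin N → G | insertAt k (τ (trunc k z)) z ∈ W} := by
  have hm : Measurable fun q : ((Fin k → G) × G) × (Fin N → G) =>
      insertAt k q.1.2 (glue q.1.1 q.2) :=
    (measurable_insertAt k).comp (measurable_fst.snd.prodMk
      (measurable_glue.comp (measurable_fst.fst.prodMk measurable_snd)))
  have hH : Measurable fun q : (Fin k → G) × G =>
      powMeasure ν N {y | insertAt k q.2 (glue q.1 y) ∈ W} := measurable_measure_prodMk_left (hm hW)
  -- The section measures obtained by inserting `s` average, over `s`, to the section measure of `W`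
  -- at `u`, hence to at most `η`. A function is at most its mean on a set of positive measure, so
  -- the admissible `s` can be selected measurably.
  obtain ⟨τ, hτ, hτV⟩ := exists_measurable_selection (powMeasure ν k) ν
    (measurableSet_le hH (measurable_const (a := η))) (by
      filter_upwards [h] with u hu
      have hHu : Measurable fun s : G => powMeasure ν N {y | insertAt k s (glue u y) ∈ W} :=
        hH.comp measurable_prodMk_left
      refine (measure_le_lintegral_pos (μ := ν) hHu.aemeasurable).trans_le (measure_mono ?_)
      intro s hs
      refine le_trans hs (le_of_eq_of_le ?_ hu)
      have hmu : MeasurableSet {y : Fin (N + 1) → G | glue u y ∈ W} :=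
        (measurable_glue_left _) hW
      rw [← (measurePreserving_insertAt ν hk).measure_preimage hmu.nullMeasurableSet,
        Measure.prod_apply (measurable_insertAt k hmu)]
      simp only [Set.preimage_ofPred_eq, glue_insertAt hk])
  refine ⟨τ, hτ, ?_⟩
  filter_upwards [hτV] with u hu
  simpa only [Set.mem_ofPred_eq, trunc_glue hk] using hu

end SmallSections

/-! ### Cocycles modulo a submodule -/

section Modulo

variable {G : Type*} [Group G] [TopologicalSpace G] [IsTopologicalGroup G]
  [SecondCountableTopology G] [T2Space G] [MeasurableSpace G] [BorelSpace G]
  {A : Type*} [AddCommGroup A] [TopologicalSpace A] [DiscreteTopology A] [DistribMulAction G A]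
  [ContinuousSMul G A]

omit [TopologicalSpace G] [IsTopologicalGroup G] [SecondCountableTopology G] [T2Space G]
  [MeasurableSpace G] [BorelSpace G] [TopologicalSpace A] [DiscreteTopology A]
  [ContinuousSMul G A] in
theorem GSubmodule.smul_mem (S : GSubmodule G A) (g : G) {a : A} (ha : a ∈ S.toAddSubgroup) :
    g • a ∈ S.toAddSubgroup := S.smul_mem' g ha

theorem measurableSet_notMem {X : Type*} [MeasurableSpace X] {f : X → A}
    (hf : StronglyMeasurable f) (S : AddSubgroup A) : MeasurableSet {x | f x ∉ S} := by
  borelize A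
  exact hf.measurable (isOpen_discrete {a : A | a ∉ S}).measurableSet

omit [DiscreteTopology A] in
theorem stronglyMeasurable_face (i : ℕ) {N : ℕ} {f : (Fin N → G) → A} (hf : StronglyMeasurable f) :
    StronglyMeasurable (face i f) := by
  rcases i with _ | i
  · have h0 : StronglyMeasurable fun g : Fin (N + 1) → G => g 0 :=
      (measurable_pi_apply (0 : Fin (N + 1))).stronglyMeasurable
    exact continuous_smul.comp_stronglyMeasurable
      (h0.prodMk (hf.comp_measurable measurable_tail))
  · exact hf.comp_measurable (measurable_contract i)

theorem stronglyMeasurable_sum_face (s : Finset ℕ) {N : ℕ} {f : (Fin N → G) → A}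
    (hf : StronglyMeasurable f) :
    StronglyMeasurable fun g => ∑ i ∈ s, (-1 : ℤ) ^ i • face i f g :=
  Finset.stronglyMeasurable_fun_sum s fun i _ =>
    continuous_of_discreteTopology.comp_stronglyMeasurable (g := fun a : A => (-1 : ℤ) ^ i • a)
      (stronglyMeasurable_face i hf)

theorem stronglyMeasurable_partialD (k : ℕ) {N : ℕ} {f : (Fin N → G) → A}
    (hf : StronglyMeasurable f) : StronglyMeasurable (partialD k f) :=
  stronglyMeasurable_sum_face _ hf

theorem stronglyMeasurable_partialE (k : ℕ) {N : ℕ} {f : (Fin N → G) → A}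
    (hf : StronglyMeasurable f) : StronglyMeasurable (partialE k f) :=
  stronglyMeasurable_sum_face _ hf

omit [T2Space G] [ContinuousSMul G A] in
theorem SmallSections.face {ν : Measure G} [IsProbabilityMeasure ν] [ν.IsMulLeftInvariant]
    {k N : ℕ} {η : ENNReal} (S : GSubmodule G A) {r : (Fin N → G) → A} (hr : StronglyMeasurable r)
    (h : SmallSections ν k η {g | r g ∉ S.toAddSubgroup}) {i : ℕ} (hi : i ≤ k + 1) :
    SmallSections ν (k + 1) η {g | face i r g ∉ S.toAddSubgroup} := by
  have hW : MeasurableSet {g | r g ∉ S.toAddSubgroup} :=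
    measurableSet_notMem hr S.toAddSubgroup
  rcases i with _ | i
  · exact (h.tail_preimage hW).mono fun g hg hg' => hg (S.smul_mem _ hg')
  · exact h.contract_preimage hW (by omega)

omit [TopologicalSpace G] [IsTopologicalGroup G] [SecondCountableTopology G] [T2Space G]
  [MeasurableSpace G] [BorelSpace G] [TopologicalSpace A] [DiscreteTopology A]
  [ContinuousSMul G A] in
theorem neg_one_pow_smul_mem_iff (S : GSubmodule G A) (n : ℕ) (a : A) :
    (-1 : ℤ) ^ n • a ∈ S.toAddSubgroup ↔ a ∈ S.toAddSubgroup := by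
  rcases neg_one_pow_eq_or ℤ n with h | h <;> simp [h]

variable {ν : Measure G} [IsProbabilityMeasure ν] [ν.IsMulLeftInvariant]

/-- Subtracting a coboundary from a cocycle modulo `S` makes one more of its partial coboundaries
small modulo `S`. -/
theorem exists_smallSections_partialD_succ (S : GSubmodule G A) {k n : ℕ} (hk : k ≤ n)
    {η : ENNReal} {f : (Fin (n + 1) → G) → A} (hf : StronglyMeasurable f)
    (hcoc : ∀ᵐ g ∂powMeasure ν (n + 2), partialD (n + 2) f g ∈ S.toAddSubgroup)
    (h : SmallSections ν k η {g | partialD k f g ∉ S.toAddSubgroup}) :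
    ∃ e : (Fin n → G) → A, StronglyMeasurable e ∧
      SmallSections ν (k + 1) ((k + 2 : ℕ) * η)
        {g | partialD (k + 1) (f - partialD (n + 1) e) g ∉ S.toAddSubgroup} := by
  -- `partialD k f + partialE k f` is the full coboundary, which is in `S` almost everywhere.
  have hE : SmallSections ν k η {g | partialE k f g ∉ S.toAddSubgroup} := by
    refine h.congr_ae (by omega) ?_
    filter_upwards [hcoc] with g hg hgE hgD
    refine hgE ((S.toAddSubgroup.add_mem_cancel_left hgD).1 ?_)
    rwa [partialD_add_partialE (by omega)]
  obtain ⟨τ, hτ, hsmall⟩ := hE.exists_insertAt (by omega)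
    (measurableSet_notMem (stronglyMeasurable_partialE k hf) S.toAddSubgroup)
  let e : (Fin n → G) → A :=
    (-1 : ℤ) ^ (k + 1) • fun w => f (insertAt k (τ (trunc k w)) w)
  have he : StronglyMeasurable e :=
    continuous_of_discreteTopology.comp_stronglyMeasurable (g := fun a : A => (-1 : ℤ) ^ (k + 1) • a)
      (hf.comp_measurable ((measurable_insertAt k).comp
        ((hτ.comp (measurable_trunc k)).prodMk measurable_id)))
  have hr : StronglyMeasurable (f - partialE k e) := hf.sub (stronglyMeasurable_partialE k he)
  have hrs : SmallSections ν k η {g | (f - partialE k e) g ∉ S.toAddSubgroup} := by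
    refine hsmall.mono fun z hz hz' => hz ?_
    rwa [partialE_insertAt hk, neg_one_pow_smul_mem_iff] at hz'
  refine ⟨e, he, ?_⟩
  have h1 := SmallSections.biUnion (Finset.range (k + 2)) fun i hi =>
    hrs.face S hr (i := i) (by simp at hi; omega)
  rw [Finset.card_range] at h1
  refine h1.mono fun g hg => ?_
  -- The term `partialD k e` is killed by `partialD (k + 1)`, leaving the `k + 2` faces of the small
  -- remainder `f - partialE k e`.
  have h2 : f - partialD (n + 1) e = (f - partialE k e) - partialD k e := by
    funext z
    simp only [Pi.sub_apply, ← partialD_add_partialE (show k ≤ n + 1 by omega)]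
    abel
  simp only [Set.mem_ofPred_eq, h2, partialD_sub _ _ (partialD k e), partialD_partialD, sub_zero] at hg
  by_contra hg'
  simp only [Set.mem_iUnion, not_exists, Set.mem_ofPred_eq, not_not] at hg'
  exact hg (sum_mem fun i hi => zsmul_mem (hg' i hi) _)

/-- The corrections accumulate in `e`, and each leaves the cocycle condition intact because `d ∘ d =
0`. The factors `2, 3, …, k + 1` of the successive steps multiply to `(k + 1)!`. -/
theorem exists_smallSections_partialD (S : GSubmodule G A) {n : ℕ} {η : ENNReal}
    {f : (Fin (n + 1) → G) → A} (hf : StronglyMeasurable f)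
    (hcoc : ∀ᵐ g ∂powMeasure ν (n + 2), partialD (n + 2) f g ∈ S.toAddSubgroup)
    (h : powMeasure ν (n + 1) {g | f g ∉ S.toAddSubgroup} ≤ η) (k : ℕ) (hk : k ≤ n + 1) :
    ∃ e : (Fin n → G) → A, StronglyMeasurable e ∧
      SmallSections ν k ((k + 1).factorial * η)
        {g | partialD k (f - partialD (n + 1) e) g ∉ S.toAddSubgroup} := by
  induction k with
  | zero =>
    refine ⟨0, stronglyMeasurable_zero, ?_⟩
    have h0 : partialD (n + 1) (0 : (Fin n → G) → A) = 0 := by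
      simpa using partialD_sub (n + 1) (0 : (Fin n → G) → A) 0
    rw [h0, sub_zero]
    -- With no coordinate fixed there is a single section, and `partialD 0 f g = g 0 • f (Fin.tail
    -- g)` is in the `G`-stable `S` whenever `f (Fin.tail g)` is.
    refine Filter.Eventually.of_forall fun u => ?_
    have hu : ∀ y : Fin (n + 2) → G, glue u y = y := fun y => by
      funext m
      simp [glue]
    simp only [hu, Nat.factorial_one, Nat.zero_add, Nat.cast_one, one_mul]
    have hm := measurableSet_notMem hf S.toAddSubgroup
    rw [← (measurePreserving_tail ν (n + 1)).measure_preimage hm.nullMeasurableSet] at h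
    refine le_trans (measure_mono fun g hg => ?_) h
    intro hg'
    apply hg
    simpa [partialD, face] using S.smul_mem (g 0) hg'
  | succ k ih =>
    obtain ⟨e, he, hs⟩ := ih (by omega)
    have hf' : StronglyMeasurable (f - partialD (n + 1) e) :=
      hf.sub (stronglyMeasurable_partialD _ he)
    have hcoc' : ∀ᵐ g ∂powMeasure ν (n + 2),
        partialD (n + 2) (f - partialD (n + 1) e) g ∈ S.toAddSubgroup := by
      filter_upwards [hcoc] with g hg
      rwa [partialD_sub, partialD_partialD, sub_zero]
    obtain ⟨e', he', hs'⟩ := exists_smallSections_partialD_succ S (by omega) hf' hcoc' hs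
    refine ⟨e + e', he.add he', ?_⟩
    rw [sub_sub, ← partialD_add, ← mul_assoc, ← Nat.cast_mul] at hs'
    exact hs'

/-- A cocycle modulo `S` that lies in `S` outside of a sufficiently small set is a coboundary
modulo `S`. -/
theorem exists_sub_partialD_mem (S : GSubmodule G A) {n : ℕ}
    {f : (Fin (n + 1) → G) → A} (hf : StronglyMeasurable f)
    (hcoc : ∀ᵐ g ∂powMeasure ν (n + 2), partialD (n + 2) f g ∈ S.toAddSubgroup)
    (h : (n + 2).factorial * powMeasure ν (n + 1) {g | f g ∉ S.toAddSubgroup} < 1) :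
    ∃ e : (Fin n → G) → A, StronglyMeasurable e ∧
      ∀ᵐ g ∂powMeasure ν (n + 1), f g - partialD (n + 1) e g ∈ S.toAddSubgroup := by
  obtain ⟨e, he, hs⟩ := exists_smallSections_partialD S hf hcoc le_rfl (n + 1) le_rfl
  refine ⟨e, he, ?_⟩
  have hcoc' := ae_ae_glue (Nat.le_succ (n + 1)) hcoc
  filter_upwards [hs, hcoc'] with u hu hu'
  by_contra hmem
  refine absurd (lt_of_le_of_lt hu h) (not_lt.2 ?_)
  -- The only face outside `partialD (n + 1)` is the last, whose value at `glue u y` depends on `u`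
  -- alone. If that value is not in `S`, the section over `u` is conull, so it has measure 1.
  have h1 : ∀ᵐ y ∂powMeasure ν (n + 2), y ∈ {y | glue u y ∈
      {g | partialD (n + 1) (f - partialD (n + 1) e) g ∉ S.toAddSubgroup}} := by
    filter_upwards [hu'] with y hy hy'
    apply hmem
    have h2 : partialD (n + 2) (f - partialD (n + 1) e) (glue u y) ∈ S.toAddSubgroup := by
      rwa [partialD_sub, partialD_partialD, sub_zero]
    rw [← partialD_add_partialE (Nat.le_succ (n + 1)),
      S.toAddSubgroup.add_mem_cancel_left hy', partialE_last, neg_one_pow_smul_mem_iff] at h2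
    have h3 : Fin.init (glue u y) = u := by
      funext m
      simp only [Fin.init, glue, Fin.val_castSucc, m.2, dif_pos]
    rwa [h3] at h2
  exact ((measure_congr (Filter.eventuallyEq_univ.2 h1)).trans measure_univ).ge

end Modulo

/-! ### Cochains modulo a submodule -/

section CochainsModulo

variable {G : Type*} [Group G] [TopologicalSpace G] [IsTopologicalGroup G]
  [CompactSpace G] [T2Space G] [SecondCountableTopology G] [MeasurableSpace G] [BorelSpace G]

theorem powMeasure_smul {X : Type*} [MeasurableSpace X] (μ : Measure X) [SigmaFinite μ]
    (c : ENNReal) [SigmaFinite (c • μ)] (N : ℕ) :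
    powMeasure (c • μ) N = c ^ N • powMeasure μ N := by
  refine Measure.pi_eq fun s _ => ?_
  simp [Measure.pi_pi, Finset.prod_mul_distrib]

omit [T2Space G] in
/-- The null sets of the powers of Haar measure are those of the powers of an invariant probability
measure. -/
theorem exists_isProbabilityMeasure_ae_eq (G : Type*) [Group G] [TopologicalSpace G]
    [IsTopologicalGroup G] [CompactSpace G] [SecondCountableTopology G] [MeasurableSpace G]
    [BorelSpace G] : ∃ ν : Measure G, IsProbabilityMeasure ν ∧ ν.IsMulLeftInvariant ∧
      ∀ N, ae (powMeasure ν N) = ae (haarPow G N) := by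
  have hp : IsProbabilityMeasure (((Measure.haar : Measure G) Set.univ)⁻¹ •
    (Measure.haar : Measure G)) := inferInstance
  refine ⟨_, hp, inferInstance, fun N => ?_⟩
  rw [powMeasure_smul]
  exact Measure.ae_ennreal_smul_measure_eq
    (pow_ne_zero _ (ENNReal.inv_ne_zero.2 (measure_ne_top _ _))) _

variable {A : Type*} [AddCommGroup A] [TopologicalSpace A] [DiscreteTopology A]
  [DistribMulAction G A] [ContinuousSMul G A]

omit [CompactSpace G] [T2Space G] [TopologicalSpace A] [DiscreteTopology A]
  [ContinuousSMul G A] in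
theorem partialD_congr_ae [LocallyCompactSpace G] {N : ℕ} {f f' : (Fin N → G) → A}
    (h : f =ᵐ[haarPow G N] f') :
    partialD (N + 1) f =ᵐ[haarPow G (N + 1)] partialD (N + 1) f' := by
  have h1 := (quasiMeasurePreserving_tail (G := G) (n := N)).ae h
  have h2 := ae_all_iff.2 fun j : Fin (N + 1) => (quasiMeasurePreserving_contractNth j).ae h
  filter_upwards [h1, h2] with g hg1 hg2
  simp only [partialD, Finset.sum_range_succ' _ (N + 1), Finset.sum_range, face,
    contract_eq_contractNth, hg1, hg2]

omit [CompactSpace G] in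
theorem d_ae_eq_partialD [LocallyCompactSpace G] {N : ℕ} (φ : Cochain G A N) :
    d G A N φ =ᵐ[haarPow G (N + 1)] partialD (N + 1) φ := by
  filter_upwards [d_ae N φ] with g hg
  rw [hg]
  simp only [partialD, Finset.sum_range_succ' _ (N + 1), Finset.sum_range, face,
    contract_eq_contractNth, pow_zero, one_smul]
  exact add_comm _ _

omit [CompactSpace G] in
theorem d_d [LocallyCompactSpace G] {N : ℕ} (φ : Cochain G A N) :
    d G A (N + 1) (d G A N φ) = 0 := by
  refine AEEqFun.ext ?_
  filter_upwards [d_ae_eq_partialD (d G A N φ), partialD_congr_ae (d_ae_eq_partialD φ),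
    AEEqFun.coeFn_zero (β := A) (μ := haarPow G (N + 1 + 1))] with g h1 h2 h3
  rw [h1, h2, h3, partialD_partialD]

omit [CompactSpace G] in
theorem d_eq_zero_of_mem_coboundaries [LocallyCompactSpace G] {N : ℕ} {φ : Cochain G A N}
    (h : φ ∈ coboundaries G A N) : d G A N φ = 0 := by
  rcases N with _ | N
  · have h0 : φ = 0 := h
    rw [h0, map_zero]
  · obtain ⟨ψ, rfl⟩ := h
    exact d_d ψ

variable {ι : Type*} [Preorder ι] [IsDirectedOrder ι] {S : ι → GSubmodule G A}

omit [TopologicalSpace G] [IsTopologicalGroup G] [CompactSpace G] [T2Space G]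
  [SecondCountableTopology G] [MeasurableSpace G] [BorelSpace G] [ContinuousSMul G A] in
/-- A measurable function takes its values in one of the submodules outside of a small set. -/
theorem exists_measure_notMem_lt (hS : Monotone fun m => (S m).toAddSubgroup)
    (hunion : ⋃ m, ((S m).toAddSubgroup : Set A) = Set.univ)
    {X : Type*} [MeasurableSpace X] (μ : Measure X) [IsFiniteMeasure μ] {f : X → A}
    (hf : StronglyMeasurable f) {ε : ENNReal} (hε : 0 < ε) (i : ι) :
    ∃ m, i ≤ m ∧ μ {x | f x ∉ (S m).toAddSubgroup} < ε := by
  -- A separable subset of a discrete space is countable. This replaces the possibly uncountable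
  -- index set by an increasing sequence in it.
  have hc : (Set.range f).Countable := by
    obtain ⟨c, hc, hfc⟩ := hf.isSeparable_range
    exact hc.mono (by rwa [closure_discrete] at hfc)
  have hA : ∀ a : A, ∃ m, a ∈ (S m).toAddSubgroup := fun a => by
    have : a ∈ ⋃ m, ((S m).toAddSubgroup : Set A) := hunion ▸ Set.mem_univ a
    simpa using this
  obtain ⟨a, ha⟩ := (hc.insert 0).exists_eq_range (Set.insert_nonempty _ _)
  choose b hb using fun n => hA (a n)
  choose c hc1 hc2 using fun x y : ι => exists_ge_ge x y
  let s : ℕ → ι := fun n => Nat.rec i (fun n x => c x (b n)) n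
  have hs : Monotone s := monotone_nat_of_le_succ fun n => hc1 _ _
  have hempty : ⋂ n, {x | f x ∉ (S (s n)).toAddSubgroup} = ∅ := by
    refine Set.eq_empty_of_forall_notMem fun x hx => ?_
    obtain ⟨n, hn⟩ : f x ∈ Set.range a := ha ▸ Set.mem_insert_of_mem _ ⟨x, rfl⟩
    exact Set.mem_iInter.1 hx (n + 1) (hS (hc2 (s n) (b n)) (hn ▸ hb n))
  have hlim := tendsto_measure_iInter_atTop (μ := μ)
    (s := fun n => {x | f x ∉ (S (s n)).toAddSubgroup})
    (fun n => (measurableSet_notMem hf _).nullMeasurableSet)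
    (fun n n' h x hx hx' => hx (hS (hs h) hx')) ⟨0, measure_ne_top _ _⟩
  rw [hempty, measure_empty] at hlim
  obtain ⟨n, hn⟩ := (hlim.eventually (gt_mem_nhds hε)).exists
  exact ⟨s n, hs (Nat.zero_le n), hn⟩

/-- A cochain whose coboundary takes its values in one of the submodules differs by a coboundary
from a cochain with values in a larger one. -/
theorem exists_sub_mem_of_d_mem (hS : Monotone fun m => (S m).toAddSubgroup)
    (hunion : ⋃ m, ((S m).toAddSubgroup : Set A) = Set.univ) {p : ℕ} (φ : Cochain G A p) (i : ι)
    (h : ∀ᵐ g ∂haarPow G (p + 1), d G A p φ g ∈ (S i).toAddSubgroup) :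
    ∃ m, i ≤ m ∧ ∃ β ∈ coboundaries G A p,
      ∀ᵐ g ∂haarPow G p, (φ - β : Cochain G A p) g ∈ (S m).toAddSubgroup := by
  obtain ⟨ν, _, _, hν⟩ := exists_isProbabilityMeasure_ae_eq G
  have hφ : StronglyMeasurable φ := φ.stronglyMeasurable
  rcases p with _ | n
  · obtain ⟨m, him, hm⟩ := exists_measure_notMem_lt hS hunion (powMeasure ν 0) hφ one_pos i
    refine ⟨m, him, 0, zero_mem _, ?_⟩
    rw [sub_zero]
    refine Filter.Eventually.of_forall fun g => ?_
    by_contra hg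
    -- `G ^ 0` is a point of mass 1, so a bad set of measure less than 1 is empty.
    have : {x | φ x ∉ (S m).toAddSubgroup} = Set.univ :=
      Set.eq_univ_of_forall fun x => Subsingleton.elim g x ▸ hg
    rw [this, measure_univ] at hm
    exact lt_irrefl _ hm
  -- The threshold is `1 / (n + 2)!`, the inverse of the total loss over the `n + 1` correction
  -- steps.
  · obtain ⟨m, him, hm⟩ := exists_measure_notMem_lt hS hunion (powMeasure ν (n + 1)) hφ
      (ENNReal.inv_pos.2 (ENNReal.natCast_ne_top (n + 2).factorial)) i
    have hcoc : ∀ᵐ g ∂powMeasure ν (n + 2), partialD (n + 2) φ g ∈ (S m).toAddSubgroup := by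
      rw [hν]
      filter_upwards [h, d_ae_eq_partialD φ] with g h1 h2
      exact h2 ▸ hS him h1
    obtain ⟨e, he, hemem⟩ := exists_sub_partialD_mem (ν := ν) (S m) hφ hcoc (by
      rw [mul_comm]
      exact (ENNReal.lt_div_iff_mul_lt (by simp [Nat.factorial_ne_zero]) (by simp)).1
        (by simpa using hm))
    refine ⟨m, him, d G A n (AEEqFun.mk e he.aestronglyMeasurable), ⟨_, rfl⟩, ?_⟩
    rw [hν] at hemem
    filter_upwards [hemem, AEEqFun.coeFn_sub φ (d G A n (AEEqFun.mk e he.aestronglyMeasurable)),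
      d_ae_eq_partialD (AEEqFun.mk e he.aestronglyMeasurable),
      partialD_congr_ae (AEEqFun.coeFn_mk e he.aestronglyMeasurable)] with g h1 h2 h3 h4
    rw [h2, Pi.sub_apply, h3, h4]
    exact h1

end CochainsModulo

/-! ### Cohomology of submodules -/

section Submodules

theorem incl_injective {G : Type*} [Group G] {A : Type*} [AddCommGroup A] [DistribMulAction G A]
    (T : GSubmodule G A) : Function.Injective T.incl := Subtype.val_injective

variable {G : Type*} [Group G] [TopologicalSpace G] [IsTopologicalGroup G]
  [LocallyCompactSpace G] [MeasurableSpace G] [BorelSpace G]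
  {A : Type*} [AddCommGroup A] [TopologicalSpace A] [IsTopologicalAddGroup A]
  [DistribMulAction G A]

theorem cochainMap_injective {B : Type*} [AddCommGroup B] [TopologicalSpace B]
    [IsTopologicalAddGroup B] [DistribMulAction G B] (f : B →+[G] A) (hf : Continuous f)
    (hinj : Function.Injective f) (p : ℕ) : Function.Injective (cochainMap f hf p) := by
  intro φ ψ h
  refine AEEqFun.ext ?_
  have h' : AEEqFun.comp f hf φ = AEEqFun.comp f hf ψ := h
  filter_upwards [AEEqFun.coeFn_comp f hf φ, AEEqFun.coeFn_comp f hf ψ] with g h1 h2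
  rw [h'] at h1
  exact hinj (h1.symm.trans h2)

theorem cochainMap_incl_injective (T : GSubmodule G A) (p : ℕ) :
    Function.Injective (cochainMap T.incl T.continuous_incl p) :=
  cochainMap_injective _ _ (incl_injective T) p

theorem exists_cochainMap_incl_eq [DiscreteTopology A] (T : GSubmodule G A) {p : ℕ}
    (φ : Cochain G A p) (h : ∀ᵐ g ∂haarPow G p, φ g ∈ T.toAddSubgroup) :
    ∃ ψ : Cochain G T.Elem p, cochainMap T.incl T.continuous_incl p ψ = φ := by
  classical
  -- Any retraction of sets onto `T` will do: it is continuous because `A` is discrete, and it need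
  -- not be additive.
  let ρ : A → T.Elem := fun a => if ha : a ∈ T.toAddSubgroup then ⟨a, ha⟩ else 0
  have hρ : Continuous ρ := continuous_of_discreteTopology
  refine ⟨AEEqFun.comp ρ hρ φ, AEEqFun.ext ?_⟩
  filter_upwards [h, AEEqFun.coeFn_comp ρ hρ φ,
    AEEqFun.coeFn_comp T.incl T.continuous_incl (AEEqFun.comp ρ hρ φ)] with g h1 h2 h3
  refine h3.trans ?_
  rw [Function.comp_apply, h2, Function.comp_apply]
  change ((ρ (φ g) : T.Elem) : A) = φ g
  simp [ρ, h1]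

theorem cochainMap_incl_ae_mem (T : GSubmodule G A) {p : ℕ} (φ : Cochain G T.Elem p) :
    ∀ᵐ g ∂haarPow G p, cochainMap T.incl T.continuous_incl p φ g ∈ T.toAddSubgroup := by
  filter_upwards [AEEqFun.coeFn_comp T.incl T.continuous_incl φ] with g hg
  exact hg.symm ▸ (φ g).2

theorem cochainMap_inclusion_incl {T U : GSubmodule G A} (h : T.toAddSubgroup ≤ U.toAddSubgroup)
    {p : ℕ} (φ : Cochain G T.Elem p) :
    cochainMap U.incl U.continuous_incl p
      (cochainMap (GSubmodule.inclusion h) (GSubmodule.continuous_inclusion h) p φ) =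
        cochainMap T.incl T.continuous_incl p φ := by
  induction φ using AEEqFun.induction_on
  rfl

variable [SecondCountableTopology G] [T2Space G] [ContinuousSMul G A]

theorem H.map_mk_eq_zero_iff {B : Type*} [AddCommGroup B] [TopologicalSpace B]
    [IsTopologicalAddGroup B] [DistribMulAction G B] [ContinuousSMul G B] (f : B →+[G] A)
    (hf : Continuous f) {p : ℕ} (φ : cocycles G B p) :
    H.map f hf p (QuotientAddGroup.mk φ) = 0 ↔ cochainMap f hf p φ ∈ coboundaries G A p :=
  QuotientAddGroup.eq_zero_iff (N := (coboundaries G A p).addSubgroupOf (cocycles G A p))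
    (cocycleMap f hf p φ)

variable {ι : Type*} [Preorder ι] [DecidableEq ι]

theorem limHToH_of (S : ι → GSubmodule G A) (hS : Monotone fun m => (S m).toAddSubgroup) (p : ℕ)
    (i : ι) (x : H G (S i).Elem p) :
    limHToH S hS p (AddCommGroup.DirectLimit.of (fun m => H G (S m).Elem p)
        (fun _ _ hij => H.map (GSubmodule.inclusion (hS hij))
          (GSubmodule.continuous_inclusion (hS hij)) p) i x) =
      H.map (S i).incl (S i).continuous_incl p x :=
  AddCommGroup.DirectLimit.lift_of (H G A p) (fun m => H.map (S m).incl (S m).continuous_incl p)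
    (fun _ _ hij x => H.map_inclusion_incl (hS hij) p x) i x

end Submodules

/-! ### Bijectivity of the map from the direct limit -/

section Main

variable {G : Type*} [Group G] [TopologicalSpace G] [IsTopologicalGroup G]
  [CompactSpace G] [T2Space G] [SecondCountableTopology G] [MeasurableSpace G] [BorelSpace G]
  {A : Type*} [AddCommGroup A] [TopologicalSpace A] [DiscreteTopology A]
  [DistribMulAction G A] [ContinuousSMul G A]
  {ι : Type*} [Preorder ι] [IsDirectedOrder ι] [DecidableEq ι]

omit [IsDirectedOrder ι] [DecidableEq ι] [Preorder ι] [TopologicalSpace G] [IsTopologicalGroup G]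
  [CompactSpace G] [T2Space G] [SecondCountableTopology G] [MeasurableSpace G] [BorelSpace G]
  [TopologicalSpace A] [DiscreteTopology A] [ContinuousSMul G A] in
theorem nonempty_of_iUnion_eq_univ {S : ι → GSubmodule G A}
    (hunion : ⋃ m, ((S m).toAddSubgroup : Set A) = Set.univ) : Nonempty ι := by
  obtain ⟨m, -⟩ := Set.mem_iUnion.1 (hunion ▸ Set.mem_univ (0 : A))
  exact ⟨m⟩

theorem limHToH_injective (S : ι → GSubmodule G A) (hS : Monotone fun m => (S m).toAddSubgroup)
    (hunion : ⋃ m, ((S m).toAddSubgroup : Set A) = Set.univ) (p : ℕ) :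
    Function.Injective (limHToH S hS p) := by
  have := nonempty_of_iUnion_eq_univ hunion
  rw [injective_iff_map_eq_zero]
  intro x
  induction x using AddCommGroup.DirectLimit.induction_on with
  | ih i x =>
  induction x using QuotientAddGroup.induction_on with
  | _ φ =>
  rw [limHToH_of, H.map_mk_eq_zero_iff]
  intro hcob
  -- A class dies in the direct limit as soon as it dies at some later stage.
  suffices h : ∃ m, ∃ him : i ≤ m, cochainMap (GSubmodule.inclusion (hS him))
      (GSubmodule.continuous_inclusion (hS him)) p φ ∈ coboundaries G (S m).Elem p by
    obtain ⟨m, him, h⟩ := h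
    rw [← AddCommGroup.DirectLimit.of_f him, (H.map_mk_eq_zero_iff _ _ φ).2 h, map_zero]
  rcases p with _ | p
  · refine ⟨i, le_rfl, ?_⟩
    have h0 : (φ : Cochain G (S i).Elem 0) = 0 :=
      cochainMap_incl_injective (S i) 0 (Eq.trans hcob (map_zero _).symm)
    rw [h0, map_zero]
    exact zero_mem _
  · obtain ⟨ψ, hψ⟩ := hcob
    -- The primitive `ψ` has values in `A`, but `dψ` has values in `A_i`; subtracting `β` moves it
    -- into some `A_m` without changing its coboundary.
    obtain ⟨m, him, β, hβ, hmem⟩ := exists_sub_mem_of_d_mem hS hunion ψ i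
      (hψ ▸ cochainMap_incl_ae_mem (S i) φ.1)
    obtain ⟨ψ', hψ'⟩ := exists_cochainMap_incl_eq (S m) _ hmem
    refine ⟨m, him, ψ', cochainMap_incl_injective (S m) (p + 1) ?_⟩
    rw [cochainMap_d, hψ', map_sub, d_eq_zero_of_mem_coboundaries hβ, sub_zero, hψ,
      cochainMap_inclusion_incl]

theorem limHToH_surjective (S : ι → GSubmodule G A) (hS : Monotone fun m => (S m).toAddSubgroup)
    (hunion : ⋃ m, ((S m).toAddSubgroup : Set A) = Set.univ) (p : ℕ) :
    Function.Surjective (limHToH S hS p) := by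
  obtain ⟨i⟩ := nonempty_of_iUnion_eq_univ hunion
  intro x
  induction x using QuotientAddGroup.induction_on with
  | _ φ =>
  obtain ⟨φ, hφ⟩ := φ
  have hd : d G A p φ = 0 := hφ
  obtain ⟨m, -, β, hβ, hmem⟩ := exists_sub_mem_of_d_mem hS hunion φ i (by
    rw [hd]
    filter_upwards [AEEqFun.coeFn_zero (β := A) (μ := haarPow G (p + 1))] with g hg
    rw [hg]
    exact zero_mem _)
  obtain ⟨φ', hφ'⟩ := exists_cochainMap_incl_eq (S m) _ hmem
  -- The cocycle condition can be checked in `A`, because the inclusion is injective on cochains.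
  have hcoc : φ' ∈ cocycles G (S m).Elem p := by
    refine cochainMap_incl_injective (S m) (p + 1) ?_
    rw [cochainMap_d, hφ', map_sub, hd, d_eq_zero_of_mem_coboundaries hβ, sub_zero, map_zero]
  refine ⟨AddCommGroup.DirectLimit.of _ _ m (QuotientAddGroup.mk ⟨φ', hcoc⟩), ?_⟩
  rw [limHToH_of]
  refine QuotientAddGroup.eq.2 ?_
  change -(cochainMap (S m).incl (S m).continuous_incl p φ') + φ ∈ coboundaries G A p
  rw [hφ']
  simpa using hβ

end Main

end MeasurableCohomology

end

theorem theoremC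
    {G : Type*} [Group G] [TopologicalSpace G] [IsTopologicalGroup G]
    [CompactSpace G] [T2Space G] [SecondCountableTopology G] [MeasurableSpace G] [BorelSpace G]
    {A : Type*} [AddCommGroup A] [TopologicalSpace A] [DiscreteTopology A]
    [DistribMulAction G A] [ContinuousSMul G A]
    {ι : Type*} [Preorder ι] [IsDirectedOrder ι] [DecidableEq ι]
    (S : ι → MeasurableCohomology.GSubmodule G A)
    (hS : Monotone fun m => (S m).toAddSubgroup)
    (hunion : ⋃ m, ((S m).toAddSubgroup : Set A) = Set.univ)
    (p : ℕ) :
    Function.Bijective (MeasurableCohomology.limHToH S hS p) := by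
  exact ⟨MeasurableCohomology.limHToH_injective S hS hunion p,
    MeasurableCohomology.limHToH_surjective S hS hunion p⟩
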